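/- Theorem 1.3. All spaces are assumed to be Tychonoff. Let $G$ be a semitopological group, that is, a group with a topology for which the multiplication $G\times G\to G$ is separately continuous. Suppose that $G$ is $\omega$-narrow (for every neighborhood $U$ of the neutral element there is a countable set $A\subset G$ with $UA=AU=G$) and that $G$ is a $k$-space (a set $F\subset G$ is closed whenever $F\cap K$ is closed in $K$ for every compact $K\subset G$). Let $X$ be a nonempty pseudocompact space (every continuous real-valued function on $X$ is bounded), and suppose that $G$ acts transitively on $X$ by an action $G\times X\to X$ that is (jointly) continuous. Then the Stone–Čech compactification $\beta X$ is a Dugundji space; that is, for every embedding $i:\beta X\to Y$ into a compact Hausdorff space $Y$ there is a linear operator $u:C(\beta X)\to C(Y)$ between the spaces of continuous real-valued functions such that $u(f)\ge 0$ whenever $f\ge 0$, $u(1)=1$, and $u(f)\circ i=f$ for all $f\in C(\beta X)$. -/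

import Mathlib

open scoped Pointwise Topology

/-- A space is pseudocompact if every continuous real-valued function on it is bounded.
(The Tychonoff property is required separately.) -/
class PseudocompactSpace (X : Type*) [TopologicalSpace X] : Prop where
  exists_abs_le : ∀ f : C(X, ℝ), ∃ M : ℝ, ∀ x : X, |f x| ≤ M

/-- A group with a topology is `ω`-narrow if for every neighborhood `U` of the neutral element
there is a countable set `A` with `U * A = G` and `A * U = G`. -/
class OmegaNarrow (G : Type*) [Group G] [TopologicalSpace G] : Prop where
  exists_countable : ∀ U ∈ 𝓝 (1 : G), ∃ A : Set G, A.Countable ∧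
    U * A = Set.univ ∧ A * U = Set.univ

/-- A linear operator `u : C(X) → C(Y)` is a regular extension operator along `i : X → Y` if it
is positive, sends the constant function `1` to the constant function `1`, and sends every
function `f` on `X` to a function on `Y` whose restriction to `X` along `i` is `f`. -/
structure IsRegularExtensionOperator {X Y : Type*} [TopologicalSpace X] [TopologicalSpace Y]
    (i : C(X, Y)) (u : C(X, ℝ) →ₗ[ℝ] C(Y, ℝ)) : Prop where
  nonneg : ∀ f : C(X, ℝ), 0 ≤ f → 0 ≤ u f
  map_one : u 1 = 1
  extends_along : ∀ f : C(X, ℝ), (u f).comp i = f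

universe u v w

/-- A Dugundji space: a compact Hausdorff space `X` such that every embedding of `X` into a
compact Hausdorff space `Y` admits a regular linear extension operator `C(X) → C(Y)`.
The universe `v` of `Y` is arbitrary. -/
def IsDugundjiSpace (X : Type u) [TopologicalSpace X] : Prop :=
  CompactSpace X ∧ T2Space X ∧
    ∀ (Y : Type v) [TopologicalSpace Y] [CompactSpace Y] [T2Space Y] (i : C(X, Y)),
      Topology.IsEmbedding i → ∃ u : C(X, ℝ) →ₗ[ℝ] C(Y, ℝ), IsRegularExtensionOperator i u

/-!
Let `B` be the Stone–Čech compactification of `X`, with the action of `G` by homeomorphisms that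
extends the action on `X`.

*Separable orbits in `C(B)`.* For a compact `K ⊆ G` and a continuous function `f` on `B`, the map
`x ↦ (k ↦ f (k • x))` from the pseudocompact space `X` to `C(K)` has totally bounded range, so `f`
is translated norm-continuously over `K`. As `G` is a `k`-space, `g ↦ f ∘ g` is norm continuous on
all of `G` (`continuous_translate_stoneCech`), and as `G` is `ω`-narrow, its range is separable.

*Open quotient maps.* For a `G`-invariant set `A` of functions on `B`, consider the quotient of `B`
by the relation "all members of `A` agree". The central fact is that the quotient map is open; it
is stated as the continuity of the fibrewise minimum `fiberMin A f` of every continuous `f`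
(`continuous_fiberMin`). If `A` is generated by countably many orbits, pseudocompactness makes `X`
map onto the quotient, on which `G` therefore acts transitively. The functions
`fiberMin A (f ∘ g)`, for countably many `g`, are lower semicontinuous on the quotient, so by the
Baire category theorem they have a common point of continuity, and transitivity together with the
separability of the orbit of `f` spreads continuity over the whole quotient. A general `A` gives the
same minima as a countably generated part of it.

*Extension of maps from zero-dimensional spaces.* Since the quotient maps are open, Michael's
zero-dimensional selection argument lifts maps of a Cantor cube from the quotient modulo `A` to the
quotient modulo a set `A` enlarged by one more orbit, with prescribed values on a closed set. By
Zorn's lemma, each continuous map from a closed subset of a Cantor cube to `B` extends to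
the cube (`exists_continuous_extension`).

*Averaging.* Let `B` be embedded in a compact Hausdorff space `Y`. Toss independent coins
labelled by the continuous functions `h : Y → [0, 1]`, with success probability `h y`. The outcomes
compatible with `y` determine `y`, so the outcomes compatible with some point of `B` form a closed
subset of a Cantor cube that is mapped to `B`. Extend this map to a map `r` on the cube. Then
`u f y`, the expectation of `f ∘ r` for the coins tossed at `y`, is the required extension operator
(`isDugundjiSpace_of_extension`).
-/

namespace OrbitDugundji

open Set Filter MeasureTheory ProbabilityTheory

/-! ### Fibrewise minima and open quotients -/

section Translate

variable {G B : Type*} [Group G] [TopologicalSpace B] [MulAction G B] [ContinuousConstSMul G B]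

/-- The translate `b ↦ f (g • b)` of a continuous function `f`. -/
def translate (g : G) (f : C(B, ℝ)) : C(B, ℝ) :=
  ⟨fun b => f (g • b), f.continuous.comp (continuous_const_smul g)⟩

@[simp]
lemma translate_apply (g : G) (f : C(B, ℝ)) (b : B) : translate g f b = f (g • b) := rfl

lemma translate_translate (g k : G) (f : C(B, ℝ)) :
    translate g (translate k f) = translate (k * g) f := by
  ext b
  simp [mul_smul]

variable (G) in
/-- A set of continuous functions stable under all translations by elements of `G`. -/
def IsInvariant (A : Set C(B, ℝ)) : Prop := ∀ g : G, ∀ a ∈ A, translate g a ∈ A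

variable (G) in
/-- The set of all translates of the members of `J`. -/
def translates (J : Set C(B, ℝ)) : Set C(B, ℝ) := {a | ∃ g : G, ∃ j ∈ J, a = translate g j}

lemma isInvariant_translates (J : Set C(B, ℝ)) : IsInvariant G (translates G J) := by
  rintro g _ ⟨k, j, hj, rfl⟩
  exact ⟨k * g, j, hj, translate_translate g k j⟩

lemma subset_translates (J : Set C(B, ℝ)) : J ⊆ translates G J := by
  intro j hj
  exact ⟨1, j, hj, by ext b; simp⟩

lemma translates_subset {J A : Set C(B, ℝ)} (hA : IsInvariant G A) (h : J ⊆ A) :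
    translates G J ⊆ A := by
  rintro _ ⟨g, j, hj, rfl⟩
  exact hA g j (h hj)

end Translate

section FiberMin

variable {B : Type*} [TopologicalSpace B]

/-- The class of `b` for the equivalence relation "all members of `A` take the same value". -/
def levelSet (A : Set C(B, ℝ)) (b : B) : Set B := {b' | ∀ a ∈ A, a b' = a b}

/-- The minimum of `f` over the class of `b` modulo `A`. The infimum is attained when `B` is
compact, see `exists_eq_fiberMin`. -/
noncomputable def fiberMin (A : Set C(B, ℝ)) (f : C(B, ℝ)) (b : B) : ℝ :=
  sInf (f '' levelSet A b)

lemma mem_levelSet_self (A : Set C(B, ℝ)) (b : B) : b ∈ levelSet A b := fun _ _ => rfl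

lemma levelSet_eq_of_mem {A : Set C(B, ℝ)} {b b' : B} (h : b' ∈ levelSet A b) :
    levelSet A b' = levelSet A b := by
  ext c
  exact forall₂_congr fun a ha => by rw [h a ha]

lemma levelSet_anti {A A' : Set C(B, ℝ)} (h : A ⊆ A') (b : B) : levelSet A' b ⊆ levelSet A b :=
  fun _ hc a ha => hc a (h ha)

lemma isClosed_levelSet (A : Set C(B, ℝ)) (b : B) : IsClosed (levelSet A b) := by
  have : levelSet A b = ⋂ a ∈ A, {c | a c = a b} := by ext; simp [levelSet]
  rw [this]
  exact isClosed_biInter fun a _ => isClosed_eq a.continuous continuous_const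

lemma fiberMin_congr {A : Set C(B, ℝ)} (f : C(B, ℝ)) {b b' : B} (h : b' ∈ levelSet A b) :
    fiberMin A f b' = fiberMin A f b := by
  rw [fiberMin, levelSet_eq_of_mem h, fiberMin]

variable [CompactSpace B]

lemma exists_eq_fiberMin (A : Set C(B, ℝ)) (f : C(B, ℝ)) (b : B) :
    ∃ c ∈ levelSet A b, f c = fiberMin A f b := by
  have := ((isClosed_levelSet A b).isCompact.image f.continuous).sInf_mem
    (Set.Nonempty.image _ ⟨b, mem_levelSet_self A b⟩)
  simpa [fiberMin] using this

lemma fiberMin_le {A : Set C(B, ℝ)} (f : C(B, ℝ)) {b c : B} (h : c ∈ levelSet A b) :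
    fiberMin A f b ≤ f c :=
  csInf_le ((isClosed_levelSet A b).isCompact.image f.continuous).bddBelow ⟨c, h, rfl⟩

lemma fiberMin_mono {A A' : Set C(B, ℝ)} (h : A ⊆ A') (f : C(B, ℝ)) (b : B) :
    fiberMin A f b ≤ fiberMin A' f b := by
  obtain ⟨c, hc, hc'⟩ := exists_eq_fiberMin A' f b
  exact hc' ▸ fiberMin_le f (levelSet_anti h b hc)

lemma fiberMin_le_add (A : Set C(B, ℝ)) (f f' : C(B, ℝ)) (b : B) :
    fiberMin A f b ≤ fiberMin A f' b + ‖f - f'‖ := by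
  obtain ⟨c, hc, hc'⟩ := exists_eq_fiberMin A f' b
  have h1 := fiberMin_le f hc
  have h2 := (le_abs_self _).trans ((f - f').norm_coe_le_norm c)
  simp only [ContinuousMap.sub_apply] at h2
  linarith

lemma abs_fiberMin_sub_le (A : Set C(B, ℝ)) (f f' : C(B, ℝ)) (b : B) :
    |fiberMin A f b - fiberMin A f' b| ≤ ‖f - f'‖ := by
  have h1 := fiberMin_le_add A f f' b
  have h2 := fiberMin_le_add A f' f b
  rw [norm_sub_rev] at h2
  rw [abs_le]
  constructor <;> linarith

/-- By compactness, each value of `fiberMin A f` depends only on countably many members of `A`. -/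
lemma exists_countable_fiberMin_le (A : Set C(B, ℝ)) (f : C(B, ℝ)) (b : B) :
    ∃ J ⊆ A, J.Countable ∧ fiberMin A f b ≤ fiberMin J f b := by
  have key : ∀ n : ℕ, ∃ J : Finset A, ∀ c, (∀ a ∈ J, (a : C(B, ℝ)) c = (a : C(B, ℝ)) b) →
      fiberMin A f b - 1 / ((n : ℝ) + 1) < f c := by
    intro n
    have hcpt : IsCompact {c | f c ≤ fiberMin A f b - 1 / ((n : ℝ) + 1)} :=
      (isClosed_le f.continuous continuous_const).isCompact
    obtain ⟨J, hJ⟩ := hcpt.elim_finite_subfamily_closed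
      (fun a : A => {c | (a : C(B, ℝ)) c = (a : C(B, ℝ)) b})
      (fun a => isClosed_eq a.1.continuous continuous_const) (by
        rw [Set.eq_empty_iff_forall_notMem]
        rintro c ⟨hc, hc'⟩
        have h1 : c ∈ levelSet A b := fun a ha => by
          have := Set.mem_iInter.1 hc' ⟨a, ha⟩
          exact this
        have h2 := fiberMin_le f h1
        have h3 : (0 : ℝ) < 1 / ((n : ℝ) + 1) := by positivity
        have h4 : f c ≤ fiberMin A f b - 1 / ((n : ℝ) + 1) := hc
        linarith)
    refine ⟨J, fun c hc => ?_⟩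
    by_contra! hlt
    have : c ∈ (∅ : Set B) := hJ ▸ ⟨hlt, by simpa using fun a ha haJ => hc ⟨a, ha⟩ haJ⟩
    exact this
  choose J hJ using key
  refine ⟨⋃ n, Subtype.val '' (J n : Set A), ?_, ?_, ?_⟩
  · simp
  · exact Set.countable_iUnion fun n => ((J n).finite_toSet.image _).countable
  · obtain ⟨c, hc, hc'⟩ := exists_eq_fiberMin (⋃ n, Subtype.val '' (J n : Set A)) f b
    rw [← hc']
    refine le_of_forall_pos_le_add fun ε hε => ?_
    obtain ⟨n, hn⟩ := exists_nat_one_div_lt hε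
    have := hJ n c fun a ha => hc a (Set.mem_iUnion.2 ⟨n, a, ha, rfl⟩)
    linarith

end FiberMin

section Continuity

variable {G B : Type*} [Group G] [TopologicalSpace B] [MulAction G B] [ContinuousConstSMul G B]

lemma smul_mem_levelSet {A : Set C(B, ℝ)} (hA : IsInvariant G A) {b c : B}
    (h : c ∈ levelSet A b) (g : G) : g • c ∈ levelSet A (g • b) :=
  fun a ha => h (translate g a) (hA g a ha)

variable [CompactSpace B]

lemma fiberMin_translate {A : Set C(B, ℝ)} (hA : IsInvariant G A) (f : C(B, ℝ)) (g : G) (b : B) :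
    fiberMin A (translate g f) b = fiberMin A f (g • b) := by
  apply le_antisymm
  · obtain ⟨c, hc, hc'⟩ := exists_eq_fiberMin A f (g • b)
    rw [← hc']
    have := smul_mem_levelSet hA hc g⁻¹
    rw [inv_smul_smul] at this
    simpa using fiberMin_le (translate g f) this
  · obtain ⟨c, hc, hc'⟩ := exists_eq_fiberMin A (translate g f) b
    rw [← hc']
    exact fiberMin_le f (smul_mem_levelSet hA hc g)

variable (G B) in
/-- Every orbit of `G` in the Banach space `C(B, ℝ)` is separable; the countable dense subset is
given by a countable set of group elements. -/
def HasSeparableOrbits : Prop :=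
  ∀ f : C(B, ℝ), ∃ D : Set G, D.Countable ∧
    ∀ (g : G) (ε : ℝ), 0 < ε → ∃ d ∈ D, ‖translate g f - translate d f‖ < ε

variable (G) in
/-- The orbit of `x₀` meets every class modulo a countable set of functions, which is the form in
which the pseudocompactness of a dense orbit is used. -/
def MeetsCountableLevelSets (x₀ : B) : Prop :=
  ∀ J : Set C(B, ℝ), J.Countable → ∀ b : B, ∃ g : G, g • x₀ ∈ levelSet J b

lemma MeetsCountableLevelSets.translates (hsep : HasSeparableOrbits G B) {x₀ : B}
    (hx₀ : MeetsCountableLevelSets G x₀) {J : Set C(B, ℝ)} (hJ : J.Countable) (b : B) :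
    ∃ g : G, g • x₀ ∈ levelSet (translates G J) b := by
  choose D hDc hD using hsep
  obtain ⟨g, hg⟩ := hx₀ (⋃ j ∈ J, (fun d => translate d j) '' D j)
    (hJ.biUnion fun j _ => (hDc j).image _) b
  refine ⟨g, ?_⟩
  rintro _ ⟨k, j, hj, rfl⟩
  refine eq_of_forall_dist_le fun ε hε => ?_
  obtain ⟨d, hd, hdε⟩ := hD j k (ε / 2) (half_pos hε)
  have h0 : translate d j (g • x₀) = translate d j b :=
    hg _ (Set.mem_biUnion hj ⟨d, hd, rfl⟩)
  have h1 := (translate k j - translate d j).norm_coe_le_norm (g • x₀)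
  have h2 := (translate k j - translate d j).norm_coe_le_norm b
  rw [Real.dist_eq]
  simp only [ContinuousMap.sub_apply, Real.norm_eq_abs, abs_le] at h1 h2 ⊢
  constructor <;> linarith

/-- For a countable set `T`, the functions `fiberMin A f` with `f ∈ T` have a common point of
continuity for the topology induced on `B` by `A`: they are lower semicontinuous on the compact space
of classes modulo `A`, so that the Baire category theorem applies. -/
lemma exists_tendsto_fiberMin [Nonempty B] (A T : Set C(B, ℝ)) (hT : T.Countable) :
    ∃ b : B, ∀ f ∈ T, Tendsto (fiberMin A f)
      (comap (fun (c : B) (a : A) => (a : C(B, ℝ)) c) (𝓝 fun a : A => (a : C(B, ℝ)) b))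
      (𝓝 (fiberMin A f b)) := by
  set p : B → (A → ℝ) := fun c a => (a : C(B, ℝ)) c with hp_def
  have hp : Continuous p := continuous_pi fun a => a.1.continuous
  have hlev : ∀ b c : B, p c = p b ↔ c ∈ levelSet A b := fun b c =>
    ⟨fun h a ha => congrFun h ⟨a, ha⟩, fun h => funext fun a => h a a.2⟩
  have : CompactSpace (Set.range p) := isCompact_iff_compactSpace.1 (isCompact_range hp)
  have : Nonempty (Set.range p) := (Set.range_nonempty p).to_subtype
  -- `V f q` is the superlevel set of `fiberMin A f` in the quotient, realized as the range of `p`.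
  let V : C(B, ℝ) → ℚ → Set (Set.range p) := fun f q => {c | ∀ b, p b = c → (q : ℝ) < f b}
  have hV : ∀ f q, IsOpen (V f q) := by
    intro f q
    have : V f q = Subtype.val ⁻¹' (p '' {b | f b ≤ q})ᶜ := by
      ext c
      simp only [V, Set.mem_ofPred_eq, Set.mem_preimage, Set.mem_compl_iff, Set.mem_image, not_exists,
        not_and]
      constructor
      · intro h b hb hbc
        exact absurd (h b hbc) (not_lt.2 hb)
      · intro h b hbc
        by_contra hlt
        exact h b (not_lt.1 hlt) hbc
    rw [this]
    exact ((isClosed_le f.continuous continuous_const).isCompact.image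
      hp).isClosed.isOpen_compl.preimage continuous_subtype_val
  have hmemV : ∀ f q b,
      (⟨p b, mem_range_self b⟩ : Set.range p) ∈ V f q ↔ (q : ℝ) < fiberMin A f b := by
    intro f q b
    constructor
    · intro h
      obtain ⟨c, hc, hc'⟩ := exists_eq_fiberMin A f b
      exact hc' ▸ h c ((hlev b c).2 hc)
    · intro h c hc
      exact h.trans_le (fiberMin_le f ((hlev b c).1 hc))
  have := hT.to_subtype
  have hdense : Dense (⋂ i : T × ℚ, (frontier (V i.1 i.2))ᶜ) := by
    refine dense_iInter_of_isOpen (fun i => isClosed_frontier.isOpen_compl) fun i => ?_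
    rw [← interior_eq_empty_iff_dense_compl]
    rw [← frontier_compl]
    exact interior_frontier (hV _ _).isClosed_compl
  obtain ⟨⟨_, b, rfl⟩, hb⟩ := hdense.nonempty
  refine ⟨b, fun f hf => ?_⟩
  have hev : ∀ O : Set (Set.range p), O ∈ 𝓝 (⟨p b, mem_range_self b⟩ : Set.range p) →
      ∀ᶠ c in comap p (𝓝 (p b)), (⟨p c, mem_range_self c⟩ : Set.range p) ∈ O := by
    intro O hO
    obtain ⟨W, hW, hWO⟩ := mem_nhds_subtype _ _ _ |>.1 hO
    exact (mem_comap.2 ⟨W, hW, fun c hc => hWO hc⟩)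
  refine tendsto_order.2 ⟨fun r hr => ?_, fun r hr => ?_⟩
  · obtain ⟨q, hrq, hq⟩ := exists_rat_btwn hr
    filter_upwards [hev _ ((hV f q).mem_nhds ((hmemV f q b).2 hq))] with c hc
    exact hrq.trans ((hmemV f q c).1 hc)
  · obtain ⟨q, hq, hqr⟩ := exists_rat_btwn hr
    have h1 : (⟨p b, mem_range_self b⟩ : Set.range p) ∉ closure (V f q) := by
      have := Set.mem_iInter.1 hb (⟨f, hf⟩, q)
      rw [(hV f q).frontier_eq] at this
      intro h
      exact this ⟨h, fun h' => not_lt.2 hq.le ((hmemV f q b).1 h')⟩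
    filter_upwards [hev _ (isClosed_closure.isOpen_compl.mem_nhds h1)] with c hc
    refine lt_of_le_of_lt (not_lt.1 fun h => hc (subset_closure ((hmemV f q c).2 h))) hqr

/-- The case of a countably generated `A`, in which `G` acts transitively on the quotient: continuity
at one point spreads to all others. -/
lemma continuous_fiberMin_translates (hsep : HasSeparableOrbits G B) {x₀ : B}
    (hx₀ : MeetsCountableLevelSets G x₀) {J : Set C(B, ℝ)} (hJ : J.Countable) (f : C(B, ℝ)) :
    Continuous (fiberMin (translates G J) f) := by
  have : Nonempty B := ⟨x₀⟩
  set A := translates G J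
  have hA : IsInvariant G A := isInvariant_translates J
  obtain ⟨D, hDc, hD⟩ := hsep f
  obtain ⟨b₀, hb₀⟩ := exists_tendsto_fiberMin A ((fun d => translate d f) '' D) (hDc.image _)
  set p : B → (A → ℝ) := fun c a => (a : C(B, ℝ)) c with hp_def
  have hp : Continuous p := continuous_pi fun a => a.1.continuous
  have hall : ∀ g : G, Tendsto (fiberMin A (translate g f)) (comap p (𝓝 (p b₀)))
      (𝓝 (fiberMin A (translate g f) b₀)) := by
    intro g
    rw [Metric.tendsto_nhds]
    intro ε hε
    obtain ⟨d, hd, hdε⟩ := hD g (ε / 3) (by positivity)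
    filter_upwards [Metric.tendsto_nhds.1 (hb₀ _ ⟨d, hd, rfl⟩) (ε / 3) (by positivity)] with c hc
    have h1 := abs_fiberMin_sub_le A (translate g f) (translate d f) c
    have h2 := abs_fiberMin_sub_le A (translate g f) (translate d f) b₀
    rw [Real.dist_eq, abs_lt] at *
    rw [abs_le] at h1 h2
    constructor <;> linarith
  obtain ⟨k, hk⟩ := hx₀.translates hsep hJ b₀
  rw [continuous_iff_continuousAt]
  intro b
  obtain ⟨l, hl⟩ := hx₀.translates hsep hJ b
  -- `b` is equivalent modulo `A` to the translate `g • b₀`.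
  set g := l * k⁻¹
  have hgb : g • b₀ ∈ levelSet A b := by
    have h1 := smul_mem_levelSet hA hk g
    rw [smul_smul, inv_mul_cancel_right] at h1
    rw [← levelSet_eq_of_mem hl, levelSet_eq_of_mem h1]
    exact mem_levelSet_self A _
  have hmove : Tendsto (fun c : B => g⁻¹ • c) (𝓝 b) (comap p (𝓝 (p b₀))) := by
    rw [tendsto_comap_iff]
    have h1 : p b₀ = p (g⁻¹ • b) := by
      have := smul_mem_levelSet hA hgb g⁻¹
      rw [inv_smul_smul] at this
      exact funext fun a => this a a.2
    rw [h1]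
    exact (hp.comp (continuous_const_smul g⁻¹)).tendsto b
  have h2 := (hall g).comp hmove
  have h3 : fiberMin A (translate g f) ∘ (fun c : B => g⁻¹ • c) = fiberMin A f := by
    ext c
    simp [fiberMin_translate hA]
  rw [h3, fiberMin_translate hA, fiberMin_congr f hgb] at h2
  exact h2

/-- The quotient map of `B` modulo an invariant set `A` is open, expressed by the continuity of
the fibrewise minima. -/
theorem continuous_fiberMin (hsep : HasSeparableOrbits G B) {x₀ : B}
    (hdense : Dense (range fun g : G => g • x₀))
    (hx₀ : MeetsCountableLevelSets G x₀) {A : Set C(B, ℝ)} (hA : IsInvariant G A) (f : C(B, ℝ)) :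
    Continuous (fiberMin A f) := by
  obtain ⟨D, hDc, hD⟩ := hsep f
  choose J hJA hJc hJ using exists_countable_fiberMin_le A f
  set J₀ : Set C(B, ℝ) := ⋃ d ∈ D, J (d • x₀)
  have hJ₀A : J₀ ⊆ A := Set.iUnion₂_subset fun d _ => hJA _
  have hJ₀c : J₀.Countable := hDc.biUnion fun d _ => hJc _
  have horbit : ∀ g : G, fiberMin A f (g • x₀) ≤ fiberMin (translates G J₀) f (g • x₀) := by
    intro g
    refine le_of_forall_pos_le_add fun ε hε => ?_
    obtain ⟨d, hd, hdε⟩ := hD g (ε / 2) (half_pos hε)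
    have h1 := abs_fiberMin_sub_le A (translate g f) (translate d f) x₀
    have h2 := abs_fiberMin_sub_le (translates G J₀) (translate g f) (translate d f) x₀
    simp only [fiberMin_translate hA, fiberMin_translate (isInvariant_translates J₀)] at h1 h2
    have h3 : fiberMin A f (d • x₀) ≤ fiberMin (translates G J₀) f (d • x₀) :=
      (hJ _).trans (fiberMin_mono ((Set.subset_biUnion_of_mem hd).trans
        (subset_translates J₀)) f _)
    rw [abs_le] at h1 h2
    linarith
  have heq : fiberMin A f = fiberMin (translates G J₀) f := by
    ext b
    refine le_antisymm ?_ (fiberMin_mono (translates_subset hA hJ₀A) f b)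
    -- A larger countable set computes the value at `b`, but changes nothing on the orbit.
    have hsub : J₀ ∪ J b ⊆ A := Set.union_subset hJ₀A (hJA b)
    have h1 : fiberMin (translates G (J₀ ∪ J b)) f = fiberMin (translates G J₀) f := by
      refine (continuous_fiberMin_translates hsep hx₀ (hJ₀c.union (hJc b)) f).ext_on hdense
        (continuous_fiberMin_translates hsep hx₀ hJ₀c f) ?_
      rintro _ ⟨g, rfl⟩
      refine le_antisymm ((fiberMin_mono (translates_subset hA hsub) f _).trans (horbit g)) ?_
      exact fiberMin_mono (translates_subset (isInvariant_translates _)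
        (Set.subset_union_left.trans (subset_translates _))) f _
    rw [← h1]
    exact (hJ b).trans (fiberMin_mono (Set.subset_union_right.trans (subset_translates _)) f b)
  rw [heq]
  exact continuous_fiberMin_translates hsep hx₀ hJ₀c f

end Continuity

/-! ### Extension of maps from zero-dimensional compact spaces -/

section Refinement

variable {S B : Type*} [TopologicalSpace S] [TopologicalSpace B]

/-- In a compact totally disconnected space, an open cover has a locally constant choice of a
member containing the given point. -/
lemma exists_isLocallyConstant_mem [CompactSpace S] [T2Space S] [TotallyDisconnectedSpace S]
    {T : Type*} [Nonempty T] {W : T → Set S} (hW : ∀ t, IsOpen (W t)) (hcov : ∀ s, ∃ t, s ∈ W t) :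
    ∃ c : S → T, IsLocallyConstant c ∧ ∀ s, s ∈ W (c s) := by
  classical
  have key : ∃ V : Set S, IsClopen V ∧ univ ⊆ V ∧
      ∃ c : S → T, IsLocallyConstant c ∧ ∀ s ∈ V, s ∈ W (c s) := by
    refine isCompact_univ.induction_on (p := fun K => ∃ V : Set S, IsClopen V ∧ K ⊆ V ∧
      ∃ c : S → T, IsLocallyConstant c ∧ ∀ s ∈ V, s ∈ W (c s)) ?_ ?_ ?_ ?_
    · exact ⟨∅, isClopen_empty, subset_rfl, fun _ => Classical.arbitrary T, .const _, by simp⟩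
    · rintro K L hKL ⟨V, hV, hLV, h⟩
      exact ⟨V, hV, hKL.trans hLV, h⟩
    · rintro K L ⟨V, hV, hKV, c, hc, hcW⟩ ⟨V', hV', hLV, c', hc', hcW'⟩
      refine ⟨V ∪ V', hV.union hV', union_subset_union hKV hLV,
        fun s => if s ∈ V then c s else c' s, ?_, ?_⟩
      · rw [IsLocallyConstant.iff_eventually_eq] at hc hc' ⊢
        intro s
        by_cases hs : s ∈ V
        · filter_upwards [hV.isOpen.mem_nhds hs, hc s] with t ht ht'
          simp [hs, ht, ht']
        · filter_upwards [hV.compl.isOpen.mem_nhds hs, hc' s] with t ht ht'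
          have ht : t ∉ V := ht
          simp [hs, ht, ht']
      · intro s hs
        by_cases hsV : s ∈ V
        · simpa [hsV] using hcW s hsV
        · simpa [hsV] using hcW' s (hs.resolve_left hsV)
    · intro s _
      obtain ⟨t, ht⟩ := hcov s
      obtain ⟨V, hV, hsV, hVW⟩ := compact_exists_isClopen_in_isOpen (hW t) ht
      exact ⟨V, mem_nhdsWithin_of_mem_nhds (hV.isOpen.mem_nhds hsV), V, hV, subset_rfl,
        fun _ => t, .const t, fun _ h => hVW h⟩
  obtain ⟨V, _, hV, c, hc, hcW⟩ := key
  exact ⟨c, hc, fun s => hcW s (hV (mem_univ s))⟩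

/-- A relation is lower semicontinuous if, as a set-valued map `s ↦ {b | (s, b) ∈ P}`, it is. -/
def IsLowerSemicontinuousRel (P : Set (S × B)) : Prop :=
  ∀ O : Set B, IsOpen O → IsOpen {s | ∃ b ∈ O, (s, b) ∈ P}

/-- A relation is total if each `s` is related to some `b`. -/
def IsTotalRel (P : Set (S × B)) : Prop := ∀ s, ∃ b, (s, b) ∈ P

/-- The refinement step of Michael's zero-dimensional selection theorem: the values of a lower
semicontinuous relation are cut down to sets on which `f` varies by less than `2 * ε`. -/
lemma IsLowerSemicontinuousRel.exists_refinement [CompactSpace S] [T2Space S]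
    [TotallyDisconnectedSpace S] {P : Set (S × B)} (hP : IsLowerSemicontinuousRel P)
    (hPt : IsTotalRel P) (f : C(B, ℝ)) {ε : ℝ} (hε : 0 < ε) :
    ∃ c : S → ℝ, IsLocallyConstant c ∧
      IsLowerSemicontinuousRel {q ∈ P | |f q.2 - c q.1| < ε} ∧
      IsTotalRel {q ∈ P | |f q.2 - c q.1| < ε} := by
  have hopen : ∀ t : ℝ, IsOpen {b | |f b - t| < ε} := fun t =>
    isOpen_lt (f.continuous.sub continuous_const).abs continuous_const
  obtain ⟨c, hc, hcW⟩ := exists_isLocallyConstant_mem (fun t => hP _ (hopen t)) (fun s => by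
    obtain ⟨b, hb⟩ := hPt s
    exact ⟨f b, b, by simpa using hε, hb⟩)
  refine ⟨c, hc, fun O hO => ?_, fun s => ?_⟩
  · rw [isOpen_iff_mem_nhds]
    rintro s ⟨b, hbO, hbP, hb⟩
    filter_upwards [(hP _ (hO.inter (hopen (c s)))).mem_nhds ⟨b, ⟨hbO, hb⟩, hbP⟩,
      (IsLocallyConstant.iff_eventually_eq c).1 hc s] with t ht htc
    obtain ⟨b', ⟨h1, h2⟩, h3⟩ := ht
    exact ⟨b', h1, h3, by simpa [htc] using h2⟩
  · obtain ⟨b, hb, hbP⟩ := hcW s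
    exact ⟨b, hbP, hb⟩

/-- A closed lower semicontinuous relation may be replaced by a closed functional relation `R`
contained in it wherever `R` is defined, without losing lower semicontinuity. -/
lemma IsLowerSemicontinuousRel.prescribe [CompactSpace B] {P R : Set (S × B)}
    (hP : IsLowerSemicontinuousRel P) (hR : IsClosed R)
    (hRP : R ⊆ P) (hRf : ∀ s b b', (s, b) ∈ R → (s, b') ∈ R → b = b') :
    IsLowerSemicontinuousRel {q ∈ P | ∀ b', (q.1, b') ∈ R → q.2 = b'} := by
  intro O hO
  have h1 : IsClosed (Prod.fst '' R) := isClosedMap_fst_of_compactSpace _ hR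
  have h2 : IsClosed (Prod.fst '' (R ∩ Prod.snd ⁻¹' Oᶜ)) :=
    isClosedMap_fst_of_compactSpace _ (hR.inter (hO.isClosed_compl.preimage continuous_snd))
  have : {s | ∃ b ∈ O, (s, b) ∈ {q ∈ P | ∀ b', (q.1, b') ∈ R → q.2 = b'}} =
      {s | ∃ b ∈ O, (s, b) ∈ P} ∩ (Prod.fst '' (R ∩ Prod.snd ⁻¹' Oᶜ))ᶜ := by
    ext s
    constructor
    · rintro ⟨b, hbO, hbP, hb⟩
      refine ⟨⟨b, hbO, hbP⟩, ?_⟩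
      rintro ⟨⟨s', b'⟩, ⟨hR', hb'⟩, rfl⟩
      exact hb' (hb b' hR' ▸ hbO)
    · rintro ⟨⟨b, hbO, hbP⟩, hs⟩
      by_cases h : ∃ b', (s, b') ∈ R
      · obtain ⟨b', hb'⟩ := h
        refine ⟨b', ?_, hRP hb', fun b'' h'' => hRf s _ _ hb' h''⟩
        by_contra hO'
        exact hs ⟨(s, b'), ⟨hb', hO'⟩, rfl⟩
      · exact ⟨b, hbO, hbP, fun b' hb' => absurd ⟨b', hb'⟩ h⟩
  rw [this]
  exact (hP O hO).inter h2.isOpen_compl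

/-- Iterated refinement: a closed lower semicontinuous relation `P` has a closed total subrelation
`Q`, cut out by conditions on the functions `h n`, on the values of which each `h n` is constant.
-/
lemma IsLowerSemicontinuousRel.exists_constant_refinement [CompactSpace S] [T2Space S]
    [TotallyDisconnectedSpace S] [CompactSpace B] {P R : Set (S × B)}
    (hP : IsLowerSemicontinuousRel P) (hPt : IsTotalRel P) (hPc : IsClosed P) (hR : IsClosed R)
    (hRP : R ⊆ P) (hRf : ∀ s b b', (s, b) ∈ R → (s, b') ∈ R → b = b') (h : ℕ → C(B, ℝ)) :
    ∃ Q ⊆ P, R ⊆ Q ∧ IsClosed Q ∧ IsTotalRel Q ∧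
      (∀ s b b', (s, b) ∈ Q → (s, b') ∈ Q → ∀ n, h n b = h n b') ∧
      ∀ s b b', (s, b) ∈ Q → (s, b') ∈ P → (∀ n, h n b = h n b') → (s, b') ∈ Q := by
  let L := {P : Set (S × B) // IsLowerSemicontinuousRel P ∧ IsTotalRel P}
  choose c hcl hclsc hctot using fun (P : L) (n : ℕ) =>
    P.2.1.exists_refinement P.2.2 (h n.unpair.1) (ε := 1 / ((n.unpair.2 : ℝ) + 1)) (by positivity)
  -- Stage `n` treats the function `h k` with precision `1 / (m + 1)`, where `n` codes `(k, m)`.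
  let P₀ : L := ⟨{q ∈ P | ∀ b', (q.1, b') ∈ R → q.2 = b'}, hP.prescribe hR hRP hRf, fun s => by
    by_cases hs : ∃ b', (s, b') ∈ R
    · obtain ⟨b', hb'⟩ := hs
      exact ⟨b', hRP hb', fun b'' h'' => hRf s _ _ hb' h''⟩
    · obtain ⟨b, hb⟩ := hPt s
      exact ⟨b, hb, fun b' hb' => absurd ⟨b', hb'⟩ hs⟩⟩
  let seq : ℕ → L := fun n => Nat.rec P₀ (fun n P => ⟨_, hclsc P n, hctot P n⟩) n
  have hseq : ∀ n, (seq (n + 1)).1 = {q : S × B | q ∈ (seq n).1 ∧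
      |h n.unpair.1 q.2 - c (seq n) n q.1| < 1 / ((n.unpair.2 : ℝ) + 1)} := fun n => rfl
  have hanti : Antitone fun n => (seq n).1 :=
    antitone_nat_of_succ_le fun n => by
      rw [hseq]
      exact fun _ h => h.1
  have hseqP : ∀ n, (seq n).1 ⊆ P := fun n =>
    (hanti (Nat.zero_le n)).trans fun _ h => h.1
  let Q : Set (S × B) := P ∩ ⋂ n, {q | |h n.unpair.1 q.2 - c (seq n) n q.1| ≤
    1 / ((n.unpair.2 : ℝ) + 1)}
  have hcont : ∀ n, Continuous fun q : S × B => |h n.unpair.1 q.2 - c (seq n) n q.1| := fun n =>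
    (((h _).continuous.comp continuous_snd).sub
      ((hcl (seq n) n).continuous.comp continuous_fst)).abs
  have hQc : IsClosed Q :=
    hPc.inter (isClosed_iInter fun n => isClosed_le (hcont n) continuous_const)
  refine ⟨Q, inter_subset_left, ?_, hQc, ?_, ?_, ?_⟩
  · rintro ⟨s, b⟩ hb
    refine ⟨hRP hb, mem_iInter.2 fun n => ?_⟩
    obtain ⟨b', hb'⟩ := (seq (n + 1)).2.2 s
    have h1 : b' = b := (hanti (Nat.zero_le (n + 1)) hb').2 b hb
    rw [hseq, h1] at hb'
    exact hb'.2.le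
  · intro s
    -- The stages themselves are not closed, but their closures satisfy the weak inequalities.
    have := IsCompact.nonempty_iInter_of_sequence_nonempty_isCompact_isClosed
      (fun n => {b | (s, b) ∈ closure (seq n).1})
      (fun n b hb => closure_mono (hanti (Nat.le_succ n)) hb)
      (fun n => by
        obtain ⟨b, hb⟩ := (seq n).2.2 s
        exact ⟨b, subset_closure hb⟩)
      (isClosed_closure.preimage (by fun_prop : Continuous fun b : B => (s, b))).isCompact
      (fun n => isClosed_closure.preimage (by fun_prop : Continuous fun b : B => (s, b)))
    obtain ⟨b, hb⟩ := this
    refine ⟨b, ?_, mem_iInter.2 fun n => ?_⟩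
    · exact closure_minimal (hseqP 0) hPc (mem_iInter.1 hb 0)
    · refine closure_minimal (fun q hq => ?_) (isClosed_le (hcont n) continuous_const)
        (mem_iInter.1 hb (n + 1))
      rw [hseq] at hq
      exact hq.2.le
  · intro s b b' hb hb' k
    refine eq_of_forall_dist_le fun ε hε => ?_
    obtain ⟨m, hm⟩ := exists_nat_one_div_lt (half_pos hε)
    have h1 : |h k b - c (seq (Nat.pair k m)) (Nat.pair k m) s| ≤ 1 / ((m : ℝ) + 1) := by
      have := mem_iInter.1 hb.2 (Nat.pair k m)
      simpa only [mem_ofPred_eq, Nat.unpair_pair] using this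
    have h2 : |h k b' - c (seq (Nat.pair k m)) (Nat.pair k m) s| ≤ 1 / ((m : ℝ) + 1) := by
      have := mem_iInter.1 hb'.2 (Nat.pair k m)
      simpa only [mem_ofPred_eq, Nat.unpair_pair] using this
    rw [Real.dist_eq]
    rw [abs_le] at *
    constructor <;> linarith
  · rintro s b b' hb hb' heq
    refine ⟨hb', mem_iInter.2 fun n => ?_⟩
    have := mem_iInter.1 hb.2 n
    simpa only [mem_ofPred_eq, heq] using this

end Refinement

section Extension

variable {G B S : Type*} [Group G] [TopologicalSpace B] [CompactSpace B]
  [MulAction G B] [ContinuousConstSMul G B] [TopologicalSpace S]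

variable (G) in
/-- A partial solution of the extension problem for `R`: a continuous map from `S` to the quotient
of `B` modulo the invariant set `A`, encoded as the closed relation `P` relating `s` to all members
of the class assigned to `s`, which contains `R`. -/
structure IsPartialExtension (R : Set (S × B)) (A : Set C(B, ℝ)) (P : Set (S × B)) : Prop where
  isInvariant : IsInvariant G A
  isClosed : IsClosed P
  isTotal : IsTotalRel P
  eq_of_mem : ∀ s b b', (s, b) ∈ P → (s, b') ∈ P → ∀ a ∈ A, a b = a b'
  mem_of_eq : ∀ s b b', (s, b) ∈ P → (∀ a ∈ A, a b = a b') → (s, b') ∈ P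
  subset : R ⊆ P

/-- Partial extensions along a nonempty chain have an upper bound; the relation stays total by
compactness of `B`. -/
lemma IsPartialExtension.of_isChain {R : Set (S × B)}
    {C : Set (Set C(B, ℝ) × Set (S × B))} (hC : ∀ p ∈ C, IsPartialExtension G R p.1 p.2)
    (hchain : ∀ p ∈ C, ∀ q ∈ C, (p.1 ⊆ q.1 ∧ q.2 ⊆ p.2) ∨ (q.1 ⊆ p.1 ∧ p.2 ⊆ q.2))
    (hne : C.Nonempty) :
    IsPartialExtension G R (⋃ p ∈ C, p.1) (⋂ p ∈ C, p.2) where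
  isInvariant := by
    intro g a ha
    simp only [mem_iUnion] at ha ⊢
    obtain ⟨p, hp, hap⟩ := ha
    exact ⟨p, hp, (hC p hp).isInvariant g a hap⟩
  isClosed := isClosed_biInter fun p hp => (hC p hp).isClosed
  isTotal := by
    intro s
    have := hne.to_subtype
    have hs : Continuous fun b : B => (s, b) := by fun_prop
    obtain ⟨b, hb⟩ := IsCompact.nonempty_iInter_of_directed_nonempty_isCompact_isClosed
      (fun p : C => {b | (s, b) ∈ p.1.2})
      (fun p q => by
        rcases hchain p p.2 q q.2 with h | h
        · exact ⟨q, fun b hb => h.2 hb, subset_rfl⟩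
        · exact ⟨p, subset_rfl, fun b hb => h.2 hb⟩)
      (fun p => (hC p p.2).isTotal s)
      (fun p => ((hC p p.2).isClosed.preimage hs).isCompact)
      (fun p => (hC p p.2).isClosed.preimage hs)
    exact ⟨b, mem_iInter₂.2 fun p hp => mem_iInter.1 hb ⟨p, hp⟩⟩
  eq_of_mem := by
    intro s b b' hb hb' a ha
    simp only [mem_iUnion] at ha
    obtain ⟨p, hp, hap⟩ := ha
    exact (hC p hp).eq_of_mem s b b' (mem_iInter₂.1 hb p hp) (mem_iInter₂.1 hb' p hp) a hap
  mem_of_eq := by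
    intro s b b' hb h
    refine mem_iInter₂.2 fun p hp => (hC p hp).mem_of_eq s b b' (mem_iInter₂.1 hb p hp) ?_
    exact fun a ha => h a (mem_iUnion₂.2 ⟨p, hp, ha⟩)
  subset := subset_iInter₂ fun p hp => (hC p hp).subset

variable [T2Space B]

lemma IsPartialExtension.isLowerSemicontinuousRel {R P : Set (S × B)} {A : Set C(B, ℝ)}
    (hP : IsPartialExtension G R A P) (hcont : ∀ f, Continuous (fiberMin A f)) :
    IsLowerSemicontinuousRel P := by
  intro O hO
  rw [isOpen_iff_mem_nhds]
  rintro s ⟨b, hbO, hb⟩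
  obtain ⟨f, hf0, hf1, -⟩ := exists_continuous_zero_one_of_isClosed isClosed_singleton
    hO.isClosed_compl (disjoint_singleton_left.2 fun h : b ∈ Oᶜ => h hbO)
  have hclosed : IsClosed (Prod.fst '' (P ∩ {q | 1 / 2 ≤ fiberMin A f q.2})) :=
    isClosedMap_fst_of_compactSpace _ (hP.isClosed.inter
      (isClosed_le continuous_const ((hcont f).comp continuous_snd)))
  have hs : s ∉ Prod.fst '' (P ∩ {q | 1 / 2 ≤ fiberMin A f q.2}) := by
    rintro ⟨⟨s', b'⟩, ⟨h1, h2⟩, rfl⟩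
    have h3 : fiberMin A f b' ≤ f b := fiberMin_le f (hP.eq_of_mem _ b b' hb h1)
    have h4 : f b = 0 := hf0 rfl
    have h5 : 1 / 2 ≤ fiberMin A f b' := h2
    linarith
  filter_upwards [hclosed.isOpen_compl.mem_nhds hs] with t ht
  obtain ⟨b', hb'⟩ := hP.isTotal t
  obtain ⟨c, hc, hc'⟩ := exists_eq_fiberMin A f b'
  refine ⟨c, ?_, hP.mem_of_eq t b' c hb' fun a ha => (hc a ha).symm⟩
  by_contra hcO
  refine ht ⟨(t, b'), ⟨hb', ?_⟩, rfl⟩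
  have h1 : f c = 1 := hf1 hcO
  rw [mem_ofPred_eq, ← hc', h1]
  norm_num

variable [CompactSpace S] [T2Space S] [TotallyDisconnectedSpace S]

/-- A partial extension modulo `A` can be improved to one modulo `A` together with the orbit of
any given function. -/
lemma IsPartialExtension.exists_extension {R P : Set (S × B)} {A : Set C(B, ℝ)}
    (hP : IsPartialExtension G R A P) (hsep : HasSeparableOrbits G B)
    (hcont : ∀ f, Continuous (fiberMin A f)) (hR : IsClosed R)
    (hRf : ∀ s b b', (s, b) ∈ R → (s, b') ∈ R → b = b') (f : C(B, ℝ)) :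
    ∃ A' P', IsPartialExtension G R A' P' ∧ A ⊆ A' ∧ P' ⊆ P ∧ f ∈ A' := by
  obtain ⟨D, hDc, hD⟩ := hsep f
  have hDn : D.Nonempty := (hD 1 1 one_pos).imp fun d hd => hd.1
  obtain ⟨d, rfl⟩ := hDc.exists_eq_range hDn
  obtain ⟨Q, hQP, hRQ, hQc, hQt, hQ1, hQ2⟩ := (hP.isLowerSemicontinuousRel
    hcont).exists_constant_refinement hP.isTotal hP.isClosed hR hP.subset hRf
      fun n => translate (d n) f
  refine ⟨A ∪ translates G {f}, Q, ⟨?_, hQc, hQt, ?_, ?_, hRQ⟩, subset_union_left, hQP,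
    Or.inr (subset_translates _ rfl)⟩
  · rintro g a (ha | ha)
    · exact Or.inl (hP.isInvariant g a ha)
    · exact Or.inr (isInvariant_translates _ g a ha)
  · rintro s b b' hb hb' a (ha | ⟨g, f, rfl, rfl⟩)
    · exact hP.eq_of_mem s b b' (hQP hb) (hQP hb') a ha
    · refine eq_of_forall_dist_le fun ε hε => ?_
      obtain ⟨_, ⟨n, rfl⟩, hn⟩ := hD g (ε / 2) (half_pos hε)
      have h0 : translate (d n) f b = translate (d n) f b' := hQ1 s b b' hb hb' n
      have h1 := (translate g f - translate (d n) f).norm_coe_le_norm b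
      have h2 := (translate g f - translate (d n) f).norm_coe_le_norm b'
      rw [Real.dist_eq]
      simp only [ContinuousMap.sub_apply, Real.norm_eq_abs, abs_le] at h1 h2 ⊢
      constructor <;> linarith
  · intro s b b' hb hbb'
    refine hQ2 s b b' hb (hP.mem_of_eq s b b' (hQP hb) fun a ha => hbb' a (Or.inl ha)) fun n => ?_
    exact hbb' _ (Or.inr ⟨d n, f, rfl, rfl⟩)

/-- `B` is an absolute extensor for compact zero-dimensional spaces: a closed functional relation
`R` from `S` to `B`, that is, a continuous map from a closed subset of `S` to `B`, extends to a
continuous map on all of `S`. -/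
theorem exists_continuous_extension [Nonempty B] (hsep : HasSeparableOrbits G B)
    (hcont : ∀ A : Set C(B, ℝ), IsInvariant G A → ∀ f, Continuous (fiberMin A f))
    {R : Set (S × B)} (hR : IsClosed R) (hRf : ∀ s b b', (s, b) ∈ R → (s, b') ∈ R → b = b') :
    ∃ r : C(S, B), ∀ s b, (s, b) ∈ R → r s = b := by
  -- In a refinement `A` grows and `P` shrinks, whence the order dual on the second component.
  let E := {p : Set C(B, ℝ) × (Set (S × B))ᵒᵈ // IsPartialExtension G R p.1 (OrderDual.ofDual p.2)}
  have hbot : IsPartialExtension G R (∅ : Set C(B, ℝ)) (univ : Set (S × B)) :=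
    ⟨by simp [IsInvariant], isClosed_univ, fun s => ⟨Classical.arbitrary B, mem_univ _⟩, by simp,
      by simp, subset_univ R⟩
  have : Nonempty E := ⟨⟨(∅, OrderDual.toDual univ), hbot⟩⟩
  obtain ⟨⟨⟨A, P⟩, hP⟩, hmax⟩ := zorn_le_nonempty (α := E) fun C hC hne => by
    refine ⟨⟨(⋃ p ∈ (Subtype.val '' C : Set (Set C(B, ℝ) × Set (S × B))), p.1,
      OrderDual.toDual (⋂ p ∈ (Subtype.val '' C : Set (Set C(B, ℝ) × Set (S × B))), p.2)),
      IsPartialExtension.of_isChain ?_ ?_ (hne.image _)⟩, ?_⟩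
    · rintro _ ⟨p, hp, rfl⟩
      exact p.2
    · rintro _ ⟨p, hp, rfl⟩ _ ⟨q, hq, rfl⟩
      rcases hC.total hp hq with h | h
      · exact Or.inl ⟨h.1, h.2⟩
      · exact Or.inr ⟨h.1, h.2⟩
    · intro p hp
      exact ⟨subset_biUnion_of_mem (u := fun p : Set C(B, ℝ) × Set (S × B) => p.1) ⟨p, hp, rfl⟩,
        biInter_subset_of_mem (t := fun p : Set C(B, ℝ) × Set (S × B) => p.2) ⟨p, hp, rfl⟩⟩
  have hall : ∀ f, f ∈ A := by
    intro f
    obtain ⟨A', P', hP', hAA', hPP', hf⟩ :=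
      hP.exists_extension hsep (hcont A hP.isInvariant) hR hRf f
    exact (hmax (b := ⟨(A', OrderDual.toDual P'), hP'⟩) ⟨hAA', hPP'⟩).1 hf
  have huniq : ∀ s b b', (s, b) ∈ OrderDual.ofDual P → (s, b') ∈ OrderDual.ofDual P → b = b' := by
    intro s b b' hb hb'
    by_contra hne
    obtain ⟨f, hf0, hf1, -⟩ := exists_continuous_zero_one_of_isClosed (isClosed_singleton (x := b))
      (isClosed_singleton (x := b')) (disjoint_singleton.2 hne)
    have h1 : f b = 0 := hf0 rfl
    have h2 : f b' = 1 := hf1 rfl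
    have := hP.eq_of_mem s b b' hb hb' f (hall f)
    linarith
  choose r hr using hP.isTotal
  refine ⟨⟨r, continuous_iff_isClosed.2 fun F hF => ?_⟩, fun s b hb =>
    huniq s _ _ (hr s) (hP.subset hb)⟩
  have : r ⁻¹' F = Prod.fst '' (OrderDual.ofDual P ∩ Prod.snd ⁻¹' F) := by
    ext s
    constructor
    · exact fun hs => ⟨(s, r s), ⟨hr s, hs⟩, rfl⟩
    · rintro ⟨⟨s', b⟩, ⟨hb, hbF⟩, rfl⟩
      exact (huniq _ _ _ (hr _) hb) ▸ hbF
  rw [this]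
  exact isClosedMap_fst_of_compactSpace _ (hP.isClosed.inter (hF.preimage continuous_snd))

end Extension

/-! ### Regular extension operators from coin tossing -/

section CoinTossing

variable {ι : Type*}

/-- A continuous function on a Cantor cube depends on finitely many coordinates up to `ε`. -/
lemma exists_finset_abs_sub_lt (f : C(ι → Bool, ℝ)) {ε : ℝ} (hε : 0 < ε) :
    ∃ T : Finset ι, ∀ s s' : ι → Bool, (∀ i ∈ T, s i = s' i) → |f s - f s'| < ε := by
  classical
  have hloc : ∀ s : ι → Bool, ∃ T : Finset ι, ∀ t : ι → Bool, (∀ i ∈ T, t i = s i) →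
      |f t - f s| < ε / 2 := by
    intro s
    have ho : IsOpen {t | |f t - f s| < ε / 2} :=
      isOpen_lt (f.continuous.sub continuous_const).abs continuous_const
    obtain ⟨T, u, hu, hT⟩ := isOpen_pi_iff.1 ho s (by simpa using hε)
    exact ⟨T, fun t ht => hT fun i hi => by rw [ht i hi]; exact (hu i hi).2⟩
  choose T hT using hloc
  obtain ⟨F, hF⟩ := isCompact_univ.elim_finite_subcover
    (fun s : ι → Bool => {t : ι → Bool | ∀ i ∈ T s, t i = s i})
    (fun s => by
      have : {t : ι → Bool | ∀ i ∈ T s, t i = s i} = ⋂ i ∈ T s, {t | t i = s i} := by ext; simp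
      rw [this]
      exact isOpen_biInter_finset fun i _ =>
        (isOpen_discrete ({s i} : Set Bool)).preimage (continuous_apply (A := fun _ => Bool) i))
    (fun s _ => mem_iUnion.2 ⟨s, fun _ _ => rfl⟩)
  refine ⟨F.biUnion T, fun s s' hss' => ?_⟩
  obtain ⟨t, htF, ht⟩ := mem_iUnion₂.1 (hF (mem_univ s))
  have h1 := hT t s ht
  have h2 := hT t s' fun i hi => by
    rw [← hss' i (Finset.mem_biUnion.2 ⟨t, htF, hi⟩)]
    exact ht i hi
  rw [abs_lt] at *
  constructor <;> linarith

/-- Uniform approximation of a continuous function on a Cantor cube by functions of finitely many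
coordinates. -/
lemma exists_restrict_abs_sub_lt (f : C(ι → Bool, ℝ)) {ε : ℝ} (hε : 0 < ε) :
    ∃ (T : Finset ι) (k : (T → Bool) → ℝ), ∀ s, |k (T.restrict s) - f s| < ε := by
  classical
  obtain ⟨T, hT⟩ := exists_finset_abs_sub_lt f hε
  exact ⟨T, fun t => f fun i => if h : i ∈ T then t ⟨i, h⟩ else false, fun s =>
    hT _ _ fun i hi => by simp [hi]⟩

/-- Continuous functions on a Cantor cube are measurable for the product `σ`-algebra, even though
it is smaller than the Borel `σ`-algebra when `ι` is uncountable. -/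
lemma measurable_cantorCube (f : C(ι → Bool, ℝ)) : Measurable f := by
  choose T k hk using fun n : ℕ =>
    exists_restrict_abs_sub_lt f (ε := 1 / ((n : ℝ) + 1)) (by positivity)
  have hm : ∀ n, Measurable fun s : ι → Bool => k n ((T n).restrict s) := fun n =>
    (measurable_of_finite (k n)).comp (Finset.measurable_restrict _)
  refine measurable_of_tendsto_metrizable hm (tendsto_pi_nhds.2 fun s => ?_)
  rw [tendsto_iff_dist_tendsto_zero]
  exact squeeze_zero (fun _ => dist_nonneg) (fun n => (hk n s).le)
    tendsto_one_div_add_atTop_nhds_zero_nat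

/-- The law of independent coin tosses with success probabilities `w i`. -/
noncomputable def coinMeasure (w : ι → unitInterval) : Measure (ι → Bool) :=
  Measure.infinitePi fun i => bernoulliMeasure true false (w i)

instance (w : ι → unitInterval) : IsProbabilityMeasure (coinMeasure w) := by
  unfold coinMeasure
  infer_instance

lemma integrable_coinMeasure (w : ι → unitInterval) (f : C(ι → Bool, ℝ)) :
    Integrable f (coinMeasure w) :=
  Integrable.of_bound (measurable_cantorCube f).aestronglyMeasurable ‖f‖
    (ae_of_all _ f.norm_coe_le_norm)

/-- The coin tossing measures depend weakly continuously on the success probabilities. -/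
lemma continuous_integral_coinMeasure (f : C(ι → Bool, ℝ)) :
    Continuous fun w : ι → unitInterval => ∫ s, f s ∂coinMeasure w := by
  classical
  refine continuous_of_uniform_approx_of_continuous fun U hU => ?_
  obtain ⟨ε, hε, hεU⟩ := Metric.mem_uniformity_dist.1 hU
  obtain ⟨T, k, hk⟩ := exists_restrict_abs_sub_lt f (half_pos hε)
  refine ⟨fun w => ∫ s, k (T.restrict s) ∂coinMeasure w, ?_, fun w => hεU ?_⟩
  · have h1 : (fun w : ι → unitInterval => ∫ s, k (T.restrict s) ∂coinMeasure w) = fun w =>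
        ∑ t : T → Bool, (∏ i : T, bif t i then (w i : ℝ) else 1 - w i) * k t := by
      ext w
      rw [coinMeasure, integral_restrict_infinitePi _
        (measurable_of_finite k).aestronglyMeasurable, integral_fintype Integrable.of_finite]
      refine Finset.sum_congr rfl fun t _ => ?_
      rw [smul_eq_mul, measureReal_def, Measure.pi_singleton, ENNReal.toReal_prod]
      congr 1
      refine Finset.prod_congr rfl fun i _ => ?_
      rw [← measureReal_def]
      cases t i <;> simp
    rw [h1]
    refine continuous_finsetSum _ fun t _ => (continuous_finsetProd _ fun i _ => ?_).mul
      continuous_const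
    cases t i <;> simp only [cond_true, cond_false] <;> fun_prop
  · have hkm : Integrable (fun s : ι → Bool => k (T.restrict s)) (coinMeasure w) :=
      Integrable.of_bound ((measurable_of_finite k).comp
        (Finset.measurable_restrict _)).aestronglyMeasurable (‖f‖ + ε / 2)
        (ae_of_all _ fun s => by
          have h1 := f.norm_coe_le_norm s
          have h2 := hk s
          rw [Real.norm_eq_abs, abs_le] at *
          rw [abs_lt] at h2
          constructor <;> linarith)
    rw [dist_comm, dist_eq_norm, ← integral_sub hkm (integrable_coinMeasure w f)]
    have := norm_integral_le_of_norm_le_const (μ := coinMeasure w)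
      (f := fun s => k (T.restrict s) - f s) (ae_of_all _ fun s => (hk s).le)
    refine this.trans_lt ?_
    simpa using hε

lemma ae_coinMeasure_apply (w : ι → unitInterval) (i : ι) :
    ∀ᵐ s ∂coinMeasure w, (s i = true → w i ≠ 0) ∧ (s i = false → w i ≠ 1) := by
  have hmap : (coinMeasure w).map (fun s => s i) = bernoulliMeasure true false (w i) :=
    Measure.infinitePi_map_eval _ i
  have h : ∀ᵐ b ∂bernoulliMeasure true false (w i),
      (b = true → w i ≠ 0) ∧ (b = false → w i ≠ 1) := by
    rw [ae_iff]
    by_cases h0 : w i = 0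
    · simp [h0]
    · by_cases h1 : w i = 1
      · simp [h1]
      · simp [h0, h1]
  rw [← hmap] at h
  exact ae_of_ae_map (measurable_pi_apply i).aemeasurable h

end CoinTossing

section Milyutin

variable {Y : Type*} [TopologicalSpace Y]

/-- The sequences of outcomes that are compatible with the point `y`, when the coin labelled by `h`
is tossed with success probability `h y`. The sets for different points of a compact Hausdorff
space are disjoint, and together they form the closed domain of a Milyutin map onto `Y`. -/
def compatibleTosses (y : Y) : Set (C(Y, unitInterval) → Bool) :=
  {s | ∀ h, (s h = true → y ∈ closure {z | h z ≠ 0}) ∧ (s h = false → y ∈ closure {z | h z ≠ 1})}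

lemma isClosed_compatibleTosses :
    IsClosed {q : (C(Y, unitInterval) → Bool) × Y | q.1 ∈ compatibleTosses q.2} := by
  have : {q : (C(Y, unitInterval) → Bool) × Y | q.1 ∈ compatibleTosses q.2} =
      ⋂ h : C(Y, unitInterval), {q | (q.1 h = true → q.2 ∈ closure {z | h z ≠ 0}) ∧
        (q.1 h = false → q.2 ∈ closure {z | h z ≠ 1})} := by
    ext; simp [compatibleTosses]
  rw [this]
  refine isClosed_iInter fun h => ?_
  have hc : ∀ b : Bool, IsClopen {q : (C(Y, unitInterval) → Bool) × Y | q.1 h = b} := fun b =>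
    (isClopen_discrete {b}).preimage ((continuous_apply h).comp continuous_fst)
  exact (isClosed_imp (hc true).isOpen (isClosed_closure.preimage continuous_snd)).inter
    (isClosed_imp (hc false).isOpen (isClosed_closure.preimage continuous_snd))

/-- The coin tossing measure at `y` is concentrated on `compatibleTosses y`. As this set need not be
measurable, the fact is expressed by integrals of continuous functions. -/
lemma integral_coinMeasure_of_eqOn (y : Y) (f : C(C(Y, unitInterval) → Bool, ℝ)) (c : ℝ)
    (hf : ∀ s ∈ compatibleTosses y, f s = c) :
    ∫ s, f s ∂coinMeasure (fun h : C(Y, unitInterval) => h y) = c := by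
  set μ := coinMeasure (fun h : C(Y, unitInterval) => h y)
  let K : C(Y, unitInterval) → Set (C(Y, unitInterval) → Bool) := fun h =>
    {s | (s h = true → y ∈ closure {z | h z ≠ 0}) ∧ (s h = false → y ∈ closure {z | h z ≠ 1})}
  have hK : ∀ h, IsClosed (K h) := fun h => by
    have hc : ∀ b : Bool, IsClopen {s : C(Y, unitInterval) → Bool | s h = b} := fun b =>
      (isClopen_discrete {b}).preimage (continuous_apply h)
    exact (isClosed_imp (hc true).isOpen isClosed_const).inter
      (isClosed_imp (hc false).isOpen isClosed_const)
  have hKae : ∀ h, ∀ᵐ s ∂μ, s ∈ K h := fun h => by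
    filter_upwards [ae_coinMeasure_apply (fun h : C(Y, unitInterval) => h y) h] with s hs
    exact ⟨fun h' => subset_closure (hs.1 h'), fun h' => subset_closure (hs.2 h')⟩
  have hclose : ∀ n : ℕ, ∀ᵐ s ∂μ, |f s - c| < 1 / ((n : ℝ) + 1) := by
    intro n
    have hcpt : IsCompact {s | 1 / ((n : ℝ) + 1) ≤ |f s - c|} :=
      (isClosed_le continuous_const (f.continuous.sub continuous_const).abs).isCompact
    obtain ⟨T, hT⟩ := hcpt.elim_finite_subfamily_closed K hK (by
      rw [eq_empty_iff_forall_notMem]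
      rintro s ⟨hs, hsK⟩
      have h1 : f s = c := hf s fun h => mem_iInter.1 hsK h
      have h2 : 1 / ((n : ℝ) + 1) ≤ |f s - c| := hs
      rw [h1, sub_self, abs_zero] at h2
      have h3 : (0 : ℝ) < 1 / ((n : ℝ) + 1) := by positivity
      linarith)
    filter_upwards [(Finset.eventually_all T).2 fun h _ => hKae h] with s hs
    by_contra! hlt
    have : s ∈ (∅ : Set (C(Y, unitInterval) → Bool)) := hT ▸ ⟨hlt, mem_iInter₂.2 hs⟩
    exact this
  have hae : ∀ᵐ s ∂μ, f s = c := by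
    filter_upwards [ae_all_iff.2 hclose] with s hs
    refine eq_of_forall_dist_le fun ε hε => ?_
    obtain ⟨n, hn⟩ := exists_nat_one_div_lt hε
    exact ((hs n).trans hn).le
  rw [integral_congr_ae hae]
  simp

variable [CompactSpace Y] [T2Space Y]

lemma eq_of_mem_compatibleTosses {s : C(Y, unitInterval) → Bool} {y z : Y}
    (hy : s ∈ compatibleTosses y) (hz : s ∈ compatibleTosses z) : y = z := by
  by_contra hne
  obtain ⟨U, V, hU, hV, hyU, hzV, hUV⟩ := t2_separation hne
  obtain ⟨U', hU', hyU', hUU'⟩ := exists_mem_nhds_isClosed_subset (hU.mem_nhds hyU)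
  obtain ⟨V', hV', hzV', hVV'⟩ := exists_mem_nhds_isClosed_subset (hV.mem_nhds hzV)
  obtain ⟨f, hf0, hf1, hf⟩ := exists_continuous_zero_one_of_isClosed hyU' hzV'
    (hUV.mono hUU' hVV')
  let h : C(Y, unitInterval) := ⟨fun x => ⟨f x, hf x⟩, by fun_prop⟩
  cases hs : s h with
  | true =>
    obtain ⟨x, hxU, hx⟩ := mem_closure_iff_nhds.1 ((hy h).1 hs) U' hU'
    exact hx (Subtype.ext (hf0 hxU))
  | false =>
    obtain ⟨x, hxV, hx⟩ := mem_closure_iff_nhds.1 ((hz h).2 hs) V' hV'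
    exact hx (Subtype.ext (hf1 hxV))

/-- A compact space which is an absolute extensor for all Cantor cubes is a Dugundji space: the
compatible tosses for points of the embedded copy form a closed subset of a Cantor cube, on which a
map to `B` is given; extend it to the cube and average along the coin tossing measures. -/
theorem isDugundjiSpace_of_extension {B : Type u} [TopologicalSpace B] [CompactSpace B] [T2Space B]
    (hext : ∀ (ι : Type v) (R : Set ((ι → Bool) × B)), IsClosed R →
      (∀ s b b', (s, b) ∈ R → (s, b') ∈ R → b = b') →
      ∃ r : C(ι → Bool, B), ∀ s b, (s, b) ∈ R → r s = b) :
    IsDugundjiSpace.{u, v} B := by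
  refine ⟨inferInstance, inferInstance, fun Y _ _ _ i hi => ?_⟩
  obtain ⟨r, hr⟩ := hext C(Y, unitInterval) {q | q.1 ∈ compatibleTosses (i q.2)}
    (isClosed_compatibleTosses.preimage
      (continuous_fst.prodMk (i.continuous.comp continuous_snd)))
    (fun s b b' hb hb' => hi.injective (eq_of_mem_compatibleTosses hb hb'))
  have hev : Continuous fun (y : Y) (h : C(Y, unitInterval)) => h y :=
    continuous_pi fun h => h.continuous
  refine ⟨{ toFun := fun f => ⟨fun y =>
                ∫ s, f.comp r s ∂coinMeasure fun h : C(Y, unitInterval) => h y,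
              (continuous_integral_coinMeasure (f.comp r)).comp hev⟩
            map_add' := fun f g => ?_
            map_smul' := fun c f => ?_ }, fun f hf y => ?_, ?_, fun f => ?_⟩
  · ext y
    exact integral_add (integrable_coinMeasure _ (f.comp r)) (integrable_coinMeasure _ (g.comp r))
  · ext y
    exact integral_const_mul c _
  · exact integral_nonneg fun s => hf (r s)
  · ext y
    simp
  · ext b
    exact integral_coinMeasure_of_eqOn (i b) (f.comp r) (f b) fun s hs =>
      congrArg f (hr s b hs)

end Milyutin

/-! ### Pseudocompact spaces and the action on the Stone–Čech compactification -/

section Pseudocompact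

variable {X : Type*} [TopologicalSpace X] [PseudocompactSpace X]

lemma totallyBounded_range_of_pseudocompactSpace {M : Type*} [PseudoMetricSpace M] (T : C(X, M)) :
    TotallyBounded (range T) := by
  rw [Metric.totallyBounded_iff]
  intro ε hε
  by_contra hnot
  -- Otherwise there is an `ε`-separated sequence, which carries an unbounded sum of bump functions.
  obtain ⟨u, -, hu⟩ := exists_seq_of_forall_finset_exists (fun _ : X => True)
    (fun x y => ε ≤ dist (T x) (T y)) fun s _ => by
      by_contra hcon
      refine hnot ⟨T '' (s : Set X), s.finite_toSet.image _, ?_⟩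
      rintro _ ⟨y, rfl⟩
      by_contra hy
      refine hcon ⟨y, trivial, fun x hx => ?_⟩
      by_contra! hlt
      exact hy (mem_iUnion₂.2 ⟨T x, ⟨x, hx, rfl⟩, by rwa [Metric.mem_ball, dist_comm]⟩)
  have hsep : ∀ m n, dist (T (u m)) (T (u n)) < ε → m = n := by
    intro m n h
    rcases lt_trichotomy m n with hlt | rfl | hlt
    · exact absurd h (not_lt.2 (hu m n hlt))
    · rfl
    · exact absurd h (not_lt.2 (dist_comm (T (u m)) _ ▸ hu n m hlt))
  let φ : ℕ → X → ℝ := fun n x => n * max 0 (1 - 4 / ε * dist (T x) (T (u n)))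
  have hφsupp : ∀ n x, φ n x ≠ 0 → dist (T x) (T (u n)) < ε / 4 := by
    intro n x h
    by_contra! hle
    refine h ?_
    have : 1 ≤ 4 / ε * dist (T x) (T (u n)) := by
      rw [div_mul_eq_mul_div, le_div_iff₀ hε]
      linarith
    simp only [φ]
    rw [max_eq_left (by linarith), mul_zero]
  have hφc : ∀ n, Continuous (φ n) := fun n => by fun_prop
  have hlf : LocallyFinite fun n => Function.support (φ n) := by
    intro x
    refine ⟨{y | dist (T y) (T x) < ε / 4},
      (isOpen_lt (by fun_prop) continuous_const).mem_nhds (by simpa using hε), ?_⟩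
    refine Set.Subsingleton.finite ?_
    rintro m ⟨y, hy, hyx⟩ n ⟨z, hz, hzx⟩
    refine hsep m n ?_
    have h1 := hφsupp m y hy
    have h2 := hφsupp n z hz
    have h3 : dist (T y) (T x) < ε / 4 := hyx
    have h4 : dist (T z) (T x) < ε / 4 := hzx
    have h5 := dist_triangle4 (T (u m)) (T y) (T x) (T (u n))
    have h6 := dist_triangle (T x) (T z) (T (u n))
    rw [dist_comm (T (u m)) (T y)] at h5
    rw [dist_comm (T x) (T z)] at h6
    linarith
  obtain ⟨M, hM⟩ := PseudocompactSpace.exists_abs_le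
    (⟨fun x => ∑ᶠ n, φ n x, continuous_finsum hφc hlf⟩ : C(X, ℝ))
  obtain ⟨n, hn⟩ := exists_nat_gt M
  have hval : ∑ᶠ m, φ m (u n) = n := by
    rw [finsum_eq_single _ n fun m hmn => ?_]
    · simp [φ]
    · by_contra h
      have := hφsupp m (u n) h
      exact hmn (hsep n m (by linarith)).symm
  have := (le_abs_self _).trans (hM (u n))
  simp only [ContinuousMap.coe_mk, hval] at this
  linarith

/-- A continuous function on the product of a compact and a pseudocompact space is equicontinuous in
the compact variable. -/
lemma eventually_forall_abs_sub_lt {K : Type*} [TopologicalSpace K] [CompactSpace K]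
    (F : C(X × K, ℝ)) (k₀ : K) {ε : ℝ} (hε : 0 < ε) :
    ∀ᶠ k in 𝓝 k₀, ∀ x, |F (x, k) - F (x, k₀)| < ε := by
  obtain ⟨t, ht, htF⟩ := Metric.totallyBounded_iff.1
    (totallyBounded_range_of_pseudocompactSpace F.curry) (ε / 3) (by positivity)
  have : ∀ᶠ k in 𝓝 k₀, ∀ a ∈ t, |a k - a k₀| < ε / 3 :=
    (eventually_all_finite ht).2 fun a _ =>
      (isOpen_lt (a.continuous.sub continuous_const).abs continuous_const).mem_nhds (by
        simpa using hε)
  filter_upwards [this] with k hk x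
  obtain ⟨a, ha, hxa⟩ := mem_iUnion₂.1 (htF ⟨x, rfl⟩)
  rw [Metric.mem_ball] at hxa
  have h1 := ((F.curry x).dist_apply_le_dist (g := a) k).trans_lt hxa
  have h2 := ((F.curry x).dist_apply_le_dist (g := a) k₀).trans_lt hxa
  have h3 := hk a ha
  rw [Real.dist_eq, ContinuousMap.curry_apply] at h1 h2
  rw [abs_lt] at *
  constructor <;> linarith

/-- A pseudocompact space meets every nonempty zero set of its Stone–Čech compactification, and
more generally of any space in which it has dense image. -/
lemma exists_forall_eq_of_denseRange {B : Type*} [TopologicalSpace B] {j : C(X, B)}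
    (hj : DenseRange j) {J : Set C(B, ℝ)} (hJ : J.Countable) (b : B) :
    ∃ x, ∀ h ∈ J, h (j x) = h b := by
  rcases J.eq_empty_or_nonempty with rfl | hne
  · have : Nonempty B := ⟨b⟩
    obtain ⟨x⟩ := hj.nonempty
    exact ⟨x, by simp⟩
  obtain ⟨h, rfl⟩ := hJ.exists_eq_range hne
  let ψ : ℕ → B → ℝ := fun n c => min |h n c - h n b| ((1 / 2) ^ n)
  have hψ0 : ∀ n c, 0 ≤ ψ n c := fun n c => le_min (abs_nonneg _) (by positivity)
  have hψb : ∀ n c, ‖ψ n c‖ ≤ (1 / 2) ^ n := fun n c => by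
    rw [Real.norm_of_nonneg (hψ0 n c)]
    exact min_le_right _ _
  have hsum : ∀ c, Summable fun n => ψ n c := fun c =>
    Summable.of_norm_bounded summable_geometric_two fun n => hψb n c
  have hF : Continuous fun c => ∑' n, ψ n c :=
    continuous_tsum (fun n => by fun_prop) summable_geometric_two hψb
  have hFb : ∑' n, ψ n b = 0 := by simp [ψ]
  have hzero : ∃ x, ∑' n, ψ n (j x) = 0 := by
    by_contra! hpos
    obtain ⟨M, hM⟩ := PseudocompactSpace.exists_abs_le
      (⟨fun x => (∑' n, ψ n (j x))⁻¹, (hF.comp j.continuous).inv₀ hpos⟩ : C(X, ℝ))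
    have hcl : ∀ c, 1 ≤ M * ∑' n, ψ n c := by
      intro c
      refine hj.induction_on (p := fun c => 1 ≤ M * ∑' n, ψ n c)
        c (isClosed_le continuous_const (continuous_const.mul hF)) fun x => ?_
      have h0 : 0 < ∑' n, ψ n (j x) := lt_of_le_of_ne (tsum_nonneg fun n => hψ0 n _) (hpos x).symm
      have h1 := (le_abs_self _).trans (hM x)
      exact (inv_le_iff_one_le_mul₀ h0).1 h1
    have := hcl b
    rw [hFb, mul_zero] at this
    linarith
  obtain ⟨x, hx⟩ := hzero
  refine ⟨x, ?_⟩
  rintro _ ⟨n, rfl⟩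
  have h1 : ψ n (j x) = 0 := congrFun ((hasSum_zero_iff_of_nonneg fun n => hψ0 n (j x)).1
    (hx ▸ (hsum (j x)).hasSum)) n
  rcases min_choice |h n (j x) - h n b| ((1 / 2) ^ n) with h2 | h2
  · exact sub_eq_zero.1 (abs_eq_zero.1 (h2.symm.trans h1))
  · have h3 : (0 : ℝ) < (1 / 2) ^ n := by positivity
    exact absurd (h2.symm.trans h1) h3.ne'

end Pseudocompact

section Action

variable {G : Type w} [Group G] {X : Type u} [TopologicalSpace X] [MulAction G X]

section ConstSMul

variable [ContinuousConstSMul G X]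

/-- The action on the Stone–Čech compactification that extends an action by homeomorphisms. -/
@[reducible]
noncomputable def stoneCechMulAction : MulAction G (StoneCech X) where
  smul g := stoneCechExtend (continuous_stoneCechUnit.comp (continuous_const_smul g))
  one_smul b := by
    refine congrFun (stoneCech_hom_ext (continuous_stoneCechExtend _) continuous_id ?_) b
    ext x
    simp [stoneCechExtend_stoneCechUnit]
  mul_smul g k b := by
    refine congrFun (stoneCech_hom_ext (continuous_stoneCechExtend _)
      ((continuous_stoneCechExtend _).comp (continuous_stoneCechExtend _)) ?_) b
    ext x
    simp [stoneCechExtend_stoneCechUnit, mul_smul]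

attribute [local instance] stoneCechMulAction

lemma smul_stoneCechUnit (g : G) (x : X) :
    g • stoneCechUnit x = stoneCechUnit (g • x) :=
  stoneCechExtend_stoneCechUnit _ x

lemma continuousConstSMul_stoneCech : ContinuousConstSMul G (StoneCech X) :=
  ⟨fun _ => continuous_stoneCechExtend _⟩

lemma dense_orbit_stoneCech [MulAction.IsPretransitive G X] (x₀ : X) :
    Dense (range fun g : G => g • (stoneCechUnit x₀ : StoneCech X)) := by
  refine denseRange_stoneCechUnit.mono ?_
  rintro _ ⟨x, rfl⟩
  obtain ⟨g, rfl⟩ := MulAction.exists_smul_eq G x₀ x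
  exact ⟨g, smul_stoneCechUnit g x₀⟩

end ConstSMul

variable [TopologicalSpace G] [ContinuousSMul G X] [PseudocompactSpace X]

attribute [local instance] stoneCechMulAction continuousConstSMul_stoneCech

/-- Translation of functions on the Stone–Čech compactification is continuous in norm: this
is so on compact subsets of `G`, as `X` is pseudocompact, and `G` is a `k`-space. -/
lemma continuous_translate_stoneCech [CompactlyCoherentSpace G] (f : C(StoneCech X, ℝ)) :
    Continuous fun g : G => translate g f := by
  rw [CompactlyCoherentSpace.isCoherentWith.continuous_iff]
  intro K hK
  have : CompactSpace K := isCompact_iff_compactSpace.1 hK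
  rw [continuousOn_iff_continuous_domRestrict, continuous_iff_continuousAt]
  intro k₀
  rw [ContinuousAt, Metric.tendsto_nhds]
  intro ε hε
  let F : C(X × K, ℝ) := ⟨fun q => f (stoneCechUnit ((q.2 : G) • q.1)),
    f.continuous.comp (continuous_stoneCechUnit.comp (by fun_prop))⟩
  filter_upwards [eventually_forall_abs_sub_lt F k₀ (half_pos hε)] with k hk
  refine lt_of_le_of_lt ((ContinuousMap.dist_le (half_pos hε).le).2 fun b => ?_) (half_lt_self hε)
  refine denseRange_stoneCechUnit.induction_on (p := fun b =>
    dist (translate (k : G) f b) (translate (k₀ : G) f b) ≤ ε / 2) b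
    (isClosed_le (by fun_prop) continuous_const) fun x => ?_
  simp only [translate_apply, smul_stoneCechUnit]
  exact (hk x).le

lemma hasSeparableOrbits_stoneCech [CompactlyCoherentSpace G] [OmegaNarrow G] :
    HasSeparableOrbits G (StoneCech X) := by
  intro f
  have hU : ∀ n : ℕ, {u : G | ‖translate u f - f‖ < 1 / ((n : ℝ) + 1)} ∈ 𝓝 (1 : G) := by
    intro n
    refine (isOpen_lt ((continuous_translate_stoneCech f).sub continuous_const).norm
      continuous_const).mem_nhds ?_
    have : translate (1 : G) f = f := by ext b; simp
    change ‖translate (1 : G) f - f‖ < 1 / ((n : ℝ) + 1)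
    rw [this, sub_self, norm_zero]
    positivity
  choose D hDc hD _ using fun n => OmegaNarrow.exists_countable _ (hU n)
  refine ⟨⋃ n, D n, countable_iUnion hDc, fun g ε hε => ?_⟩
  obtain ⟨n, hn⟩ := exists_nat_one_div_lt hε
  obtain ⟨u, hu, d, hd, rfl⟩ := mem_mul.1 (hD n ▸ mem_univ g)
  refine ⟨d, mem_iUnion.2 ⟨n, hd⟩, lt_of_le_of_lt ?_ hn⟩
  have h1 : translate (u * d) f - translate d f = translate d (translate u f - f) := by
    rw [← translate_translate]
    rfl
  rw [h1]
  refine ((ContinuousMap.norm_le _ (norm_nonneg _)).2 fun b => ?_).trans (le_of_lt hu)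
  exact (translate u f - f).norm_coe_le_norm (d • b)

lemma meetsCountableLevelSets_stoneCech [MulAction.IsPretransitive G X] (x₀ : X) :
    MeetsCountableLevelSets G (stoneCechUnit x₀ : StoneCech X) := by
  intro J hJ b
  obtain ⟨x, hx⟩ := exists_forall_eq_of_denseRange
    (j := (⟨stoneCechUnit, continuous_stoneCechUnit⟩ : C(X, StoneCech X)))
    denseRange_stoneCechUnit hJ b
  obtain ⟨g, rfl⟩ := MulAction.exists_smul_eq G x₀ x
  exact ⟨g, fun h hh => by rw [smul_stoneCechUnit]; exact hx h hh⟩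

end Action

end OrbitDugundji

open OrbitDugundji in
theorem theorem1p3 {G : Type w} [Group G] [TopologicalSpace G] [T35Space G]
    [SeparatelyContinuousMul G] [OmegaNarrow G] [CompactlyCoherentSpace G]
    {X : Type u} [TopologicalSpace X] [T35Space X] [Nonempty X] [PseudocompactSpace X]
    [MulAction G X] [ContinuousSMul G X] [MulAction.IsPretransitive G X] :
    IsDugundjiSpace.{u, v} (StoneCech X) := by
  let _ : MulAction G (StoneCech X) := stoneCechMulAction
  have : ContinuousConstSMul G (StoneCech X) := continuousConstSMul_stoneCech
  obtain ⟨x₀⟩ := ‹Nonempty X›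
  have : Nonempty (StoneCech X) := ⟨stoneCechUnit x₀⟩
  have hsep : HasSeparableOrbits G (StoneCech X) := hasSeparableOrbits_stoneCech
  exact isDugundjiSpace_of_extension fun ι R hR hRf =>
    exists_continuous_extension hsep (fun A hA f => continuous_fiberMin hsep
      (dense_orbit_stoneCech x₀) (meetsCountableLevelSets_stoneCech x₀) hA f) hR hRf
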